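/- Let $G$ be a finite simple graph on $n$ vertices that has a universal vertex (one adjacent to every other vertex) and is not complete (so $G$ has diameter two), let $k$ be the vertex connectivity of $G$ (the largest $k$ such that $G$ has more than $k$ vertices and remains connected after the deletion of any set of fewer than $k$ vertices), and let $t\ge 1$. A configuration $C:V(G)\to\mathbb{N}$ has size $\sum_v C(v)$; a pebbling step removes two pebbles from a vertex carrying at least two and adds one pebble to a neighbour of it. For a vertex $r$, let $\pi_t(G,r)$ be the least positive integer $m$ such that from every configuration of size $m$ some sequence of pebbling steps places at least $t$ pebbles on $r$, and let $\pi_t(G)=\max_{r\in V(G)}\pi_t(G,r)$ be the $t$-pebbling number of $G$. Then $$\pi_t(G)=\max\{\,n+4t-k-2,\ n+2t-2\,\}.$$ Moreover $n+2t-2\ge n+4t-k-2$ if and only if $k\ge 2t$. -/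

import Mathlib

/-- A pebbling configuration: `C v` is the number of pebbles on the vertex `v`. -/
abbrev PebblingConfig (V : Type*) := V → ℕ

/-- The size of a configuration, i.e. its total number of pebbles. -/
def PebblingConfig.size {V : Type*} [Fintype V] (C : PebblingConfig V) : ℕ := ∑ v, C v

/-- `C'` arises from `C` by one pebbling step: two pebbles are removed from some vertex `u`
(which therefore carries at least two) and one pebble is added to a neighbour `v` of `u`. -/
def PebblingStep {V : Type*} (G : SimpleGraph V) (C C' : PebblingConfig V) : Prop :=
  ∃ u v, G.Adj u v ∧ C u = C' u + 2 ∧ C' v = C v + 1 ∧ ∀ w, w ≠ u → w ≠ v → C' w = C w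

/-- `C` is `t`-fold `r`-solvable: some finite (possibly empty) sequence of pebbling steps leads
from `C` to a configuration with at least `t` pebbles on the root `r`. -/
def IsFoldSolvable {V : Type*} (G : SimpleGraph V) (t : ℕ) (r : V) (C : PebblingConfig V) :
    Prop :=
  ∃ C' : PebblingConfig V, Relation.ReflTransGen (PebblingStep G) C C' ∧ t ≤ C' r

/-- The rooted `t`-pebbling number `π_t(G, r)`: the least positive integer `m` such that every
configuration of size `m` is `t`-fold `r`-solvable, and `⊤` if there is no such `m`. -/
noncomputable def rootedPebblingNumber {V : Type*} [Fintype V] (G : SimpleGraph V) (t : ℕ)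
    (r : V) : ℕ∞ :=
  sInf {x : ℕ∞ | ∃ m : ℕ, x = m ∧ 0 < m ∧
    ∀ C : PebblingConfig V, C.size = m → IsFoldSolvable G t r C}

/-- The `t`-pebbling number `π_t(G)`, the maximum of `π_t(G, r)` over all vertices `r`. -/
noncomputable def pebblingNumber {V : Type*} [Fintype V] (G : SimpleGraph V) (t : ℕ) : ℕ∞ :=
  ⨆ r : V, rootedPebblingNumber G t r

/-- `G` has more than `k` vertices and stays connected after deleting any set of fewer than `k`
vertices. -/
def IsAtLeastKConnected {V : Type*} [Fintype V] (G : SimpleGraph V) (k : ℕ) : Prop :=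
  k < Fintype.card V ∧ ∀ S : Finset V, S.card < k → (G.induce {v | v ∉ S}).Connected

/-- The (vertex) connectivity of `G`: the largest `k` for which the previous property holds. It is
the least size of a vertex cut when `G` is not complete. -/
noncomputable def vertexConnectivity {V : Type*} [Fintype V] (G : SimpleGraph V) : ℕ :=
  sSup {k : ℕ | IsAtLeastKConnected G k}

open Finset Relation

/-! ### Pebbling reachability -/

/-! Upper bound: split a configuration into the pebbles on `r`, pairs on neighbours of `r`, pairs on
vertices far from `r`, and one leftover pebble on each vertex of the set `H` of non-root vertices
with an odd count. A neighbouring pair yields one pebble on `r`. Two far pairs always yield one, by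
meeting at the universal vertex. A single far pair also yields one if it can travel to a neighbour
of `r` through vertices of `H`, picking up the leftover pebble at each to become a pair again. If
`d` non-root vertices lie outside `H`, then `k`-connectivity and Hall's theorem provide disjoint
routes of this kind for up to `k - d` far pairs (`IsAtLeastKConnected.isFoldSolvable`). The two size
hypotheses are what the resulting count needs (`isFoldSolvable_of_le_size`).

Lower bound: two configurations defeat `r`, both handled by one non-increasing potential
(`not_isFoldSolvable_of_separated`). One puts `4t - 1` pebbles on a vertex `s` that a cut of at most
`k` empty vertices separates from `r`; the other puts `2t - 1` on `s` and uses no cut. All remaining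
vertices except `r` carry one pebble. -/

theorem pebblingStep_add_single {V : Type*} [DecidableEq V] {G : SimpleGraph V} {u v : V}
    (h : G.Adj u v) (E : PebblingConfig V) :
    PebblingStep G (Pi.single u 2 + E) (Pi.single v 1 + E) := by
  have huv := h.ne
  refine ⟨u, v, h, ?_, ?_, fun w hu hv => ?_⟩
  · simp [huv, add_comm]
  · simp [huv.symm, add_comm]
  · simp [hu, hv]

theorem PebblingStep.add_right {V : Type*} {G : SimpleGraph V} {C C' : PebblingConfig V}
    (h : PebblingStep G C C') (E : PebblingConfig V) : PebblingStep G (C + E) (C' + E) := by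
  obtain ⟨u, v, ha, hu, hv, hw⟩ := h
  refine ⟨u, v, ha, ?_, ?_, fun w h1 h2 => ?_⟩
  · simp only [Pi.add_apply]; omega
  · simp only [Pi.add_apply]; omega
  · simp [hw w h1 h2]

/-- `C'` is reachable from `C` by pebbling steps. -/
abbrev PebblingReach {V : Type*} (G : SimpleGraph V) (C C' : PebblingConfig V) : Prop :=
  ReflTransGen (PebblingStep G) C C'

theorem PebblingReach.add_right {V : Type*} {G : SimpleGraph V} {C C' : PebblingConfig V}
    (h : PebblingReach G C C') (E : PebblingConfig V) : PebblingReach G (C + E) (C' + E) :=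
  ReflTransGen.lift (· + E) (fun _ _ h => PebblingStep.add_right h E) _ _ h

theorem PebblingReach.add {V : Type*} {G : SimpleGraph V} {A A' B B' : PebblingConfig V}
    (h : PebblingReach G A A') (h' : PebblingReach G B B') :
    PebblingReach G (A + B) (A' + B') := by
  refine (h.add_right B).trans ?_
  rw [add_comm A', add_comm A']
  exact h'.add_right A'

theorem IsFoldSolvable.add {V : Type*} {G : SimpleGraph V} {s t : ℕ} {r : V}
    {A B : PebblingConfig V} (h : IsFoldSolvable G s r A) (h' : IsFoldSolvable G t r B) :
    IsFoldSolvable G (s + t) r (A + B) := by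
  obtain ⟨A', hA, hs⟩ := h
  obtain ⟨B', hB, ht⟩ := h'
  exact ⟨A' + B', PebblingReach.add hA hB, Nat.add_le_add hs ht⟩

theorem IsFoldSolvable.of_zero {V : Type*} (G : SimpleGraph V) (r : V) (C : PebblingConfig V) :
    IsFoldSolvable G 0 r C :=
  ⟨C, .refl, Nat.zero_le _⟩

theorem IsFoldSolvable.mono_config {V : Type*} {G : SimpleGraph V} {t : ℕ} {r : V}
    {C D : PebblingConfig V} (h : IsFoldSolvable G t r C) (hCD : C ≤ D) :
    IsFoldSolvable G t r D := by
  have := h.add (IsFoldSolvable.of_zero G r (D - C))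
  rwa [add_tsub_cancel_of_le hCD, add_zero] at this

theorem IsFoldSolvable.anti {V : Type*} {G : SimpleGraph V} {s t : ℕ} {r : V}
    {C : PebblingConfig V} (h : IsFoldSolvable G t r C) (hst : s ≤ t) :
    IsFoldSolvable G s r C := by
  obtain ⟨C', hC, ht⟩ := h
  exact ⟨C', hC, hst.trans ht⟩

theorem IsFoldSolvable.of_reach {V : Type*} {G : SimpleGraph V} {t : ℕ} {r : V}
    {C D : PebblingConfig V} (hCD : PebblingReach G C D) (h : IsFoldSolvable G t r D) :
    IsFoldSolvable G t r C := by
  obtain ⟨C', hC, ht⟩ := h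
  exact ⟨C', hCD.trans hC, ht⟩

theorem pebblingReach_single {V : Type*} [DecidableEq V] {G : SimpleGraph V} {u v : V}
    (h : G.Adj u v) (a : ℕ) :
    PebblingReach G (Pi.single u (2 * a)) (Pi.single v a) := by
  induction a with
  | zero => simpa using ReflTransGen.refl
  | succ a ih =>
    have h3 : (Pi.single u (2 * (a + 1)) : V → ℕ) = Pi.single u 2 + Pi.single u (2 * a) := by
      rw [← Pi.single_add]; congr 1; ring
    have h4 : (Pi.single v (a + 1) : V → ℕ) = Pi.single v 1 + Pi.single v a := by
      rw [← Pi.single_add, add_comm]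
    rw [h3, h4]
    refine PebblingReach.add ?_ ih
    simpa using ReflTransGen.single (pebblingStep_add_single h 0)

/-- If all vertices carrying pebbles are neighbours of `x`, half of them can be moved to `x`. -/
theorem pebblingReach_neighbor {V : Type*} [Fintype V] [DecidableEq V] {G : SimpleGraph V} {x : V}
    (b : V → ℕ) (hb : ∀ v, b v ≠ 0 → G.Adj v x) :
    PebblingReach G (fun v => 2 * b v) (Pi.single x (∑ v, b v)) := by
  have key : ∀ s : Finset V, PebblingReach G (∑ v ∈ s, Pi.single v (2 * b v))
      (Pi.single x (∑ v ∈ s, b v)) := by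
    intro s
    induction s using Finset.induction_on with
    | empty => simpa using ReflTransGen.refl
    | insert a s ha ih =>
      rw [sum_insert ha, sum_insert ha, Pi.single_add]
      refine PebblingReach.add ?_ ih
      by_cases h : b a = 0
      · simpa [h] using ReflTransGen.refl
      · exact pebblingReach_single (hb a h) _
  have := key univ
  rwa [Finset.univ_sum_single] at this

theorem isFoldSolvable_single {V : Type*} [DecidableEq V] (G : SimpleGraph V) (r : V) (a : ℕ) :
    IsFoldSolvable G a r (Pi.single r a) :=
  ⟨_, .refl, by simp⟩

/-- A set `I` of pairs of pebbles at the vertices `pos i` can be pushed through the vertices of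
`H`, each carrying one pebble, along a matching given by `f` and `g` until each reaches `r`. -/
theorem isFoldSolvable_of_matching {V ι : Type*} [DecidableEq V] [DecidableEq ι]
    {G : SimpleGraph V} {r : V} (g : V → V) (N : ℕ) :
    ∀ (I : Finset ι) (pos f : ι → V) (H : Finset V), #H = N →
      (∀ i ∈ I, f i ∈ H ∧ G.Adj (pos i) (f i)) →
      (∀ v ∈ H, ¬ G.Adj v r → g v ∈ H ∧ (g v = v ∨ G.Adj v (g v))) →
      Set.InjOn f I →
      (∀ v ∈ H, ∀ w ∈ H, ¬ G.Adj v r → ¬ G.Adj w r → g v = g w → v = w) →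
      (∀ i ∈ I, ∀ v ∈ H, ¬ G.Adj v r → f i ≠ g v) →
      IsFoldSolvable G #I r (∑ i ∈ I, Pi.single (pos i) 2 + ∑ v ∈ H, Pi.single v 1) := by
  induction N with
  | zero =>
    intro I pos f H hH hf _ _ _ _
    rcases I.eq_empty_or_nonempty with rfl | ⟨i, hi⟩
    · exact .of_zero _ _ _
    · have := (hf i hi).1
      rw [card_eq_zero.1 hH] at this
      simp at this
  | succ N ih =>
    intro I pos f H hH hf hg hfi hgi hfg
    rcases I.eq_empty_or_nonempty with rfl | ⟨i, hi⟩
    · exact .of_zero _ _ _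
    obtain ⟨hvH, hadj⟩ := hf i hi
    have hcard : #(H.erase (f i)) = N := by rw [card_erase_of_mem hvH, hH]; rfl
    have hne : ∀ j ∈ I.erase i, f j ≠ f i := fun j hj h =>
      ne_of_mem_erase hj (hfi (mem_of_mem_erase hj) hi h)
    have hgne : ∀ w ∈ H, ¬ G.Adj w r → g w ≠ f i := fun w hw hwr h => hfg i hi w hw hwr h.symm
    -- One pebble of pair `i` arrives at `f i` and joins the pebble there: the pair has moved to `f
    -- i`, and `f i` is used up and leaves `H`.
    have hreach : PebblingReach G
        (∑ i ∈ I, Pi.single (pos i) 2 + ∑ v ∈ H, Pi.single v 1)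
        (Pi.single (f i) 2 +
          (∑ i ∈ I.erase i, Pi.single (pos i) 2 + ∑ v ∈ H.erase (f i), Pi.single v 1)) := by
      have h := pebblingStep_add_single hadj (Pi.single (f i) 1 +
          (∑ i ∈ I.erase i, Pi.single (pos i) 2 + ∑ v ∈ H.erase (f i), Pi.single v 1))
      have h2 : (Pi.single (f i) 2 : V → ℕ) = Pi.single (f i) 1 + Pi.single (f i) 1 := by
        rw [← Pi.single_add]
      rw [h2, ← add_sum_erase I _ hi, ← add_sum_erase H _ hvH]
      convert ReflTransGen.single h using 1 <;> abel
    refine .of_reach hreach ?_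
    by_cases hvr : G.Adj (f i) r
    · refine .of_reach (.single (pebblingStep_add_single hvr _)) ?_
      have h1 := ih (I.erase i) pos f (H.erase (f i)) hcard
        (fun j hj => ⟨mem_erase.2 ⟨hne j hj, (hf j (mem_of_mem_erase hj)).1⟩,
          (hf j (mem_of_mem_erase hj)).2⟩)
        (fun w hw hwr => ⟨mem_erase.2 ⟨hgne w (mem_of_mem_erase hw) hwr,
          (hg w (mem_of_mem_erase hw) hwr).1⟩, (hg w (mem_of_mem_erase hw) hwr).2⟩)
        (hfi.mono (by simp))
        (fun v hv w hw => hgi v (mem_of_mem_erase hv) w (mem_of_mem_erase hw))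
        (fun j hj v hv => hfg j (mem_of_mem_erase hj) v (mem_of_mem_erase hv))
      have h2 := (isFoldSolvable_single G r 1).add h1
      refine h2.anti ?_
      rw [card_erase_of_mem hi]; omega
    · obtain ⟨hgH, hgadj⟩ := hg (f i) hvH hvr
      -- A fixed point of `g` marks an unused vertex: routes enter vertices only as values of `f` or
      -- from a different vertex under `g`, so injectivity keeps them away from fixed points.
      have hgv := hgne (f i) hvH hvr
      have h1 := ih I (Function.update pos i (f i)) (Function.update f i (g (f i)))
        (H.erase (f i)) hcard
        (fun j hj => by
          rcases eq_or_ne j i with rfl | hji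
          · simpa using ⟨⟨hgv, hgH⟩, hgadj.resolve_left hgv⟩
          · have := hne j (mem_erase.2 ⟨hji, hj⟩)
            simpa [hji, this] using hf j hj)
        (fun w hw hwr => ⟨mem_erase.2 ⟨hgne w (mem_of_mem_erase hw) hwr,
          (hg w (mem_of_mem_erase hw) hwr).1⟩, (hg w (mem_of_mem_erase hw) hwr).2⟩)
        (fun j hj l hl h => by
          rcases eq_or_ne j i with rfl | hji <;> rcases eq_or_ne l j with rfl | hlj
          · rfl
          · simp only [Function.update_self, Function.update_of_ne hlj] at h
            exact absurd h.symm (hfg l hl _ hvH hvr)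
          · rfl
          · rcases eq_or_ne l i with rfl | hli
            · simp only [Function.update_self, Function.update_of_ne hji] at h
              exact absurd h (hfg j hj _ hvH hvr)
            · simp only [Function.update_of_ne hji, Function.update_of_ne hli] at h
              exact hfi hj hl h)
        (fun v hv w hw => hgi v (mem_of_mem_erase hv) w (mem_of_mem_erase hw))
        (fun j hj w hw hwr h => by
          rcases eq_or_ne j i with rfl | hji
          · simp only [Function.update_self] at h
            exact ne_of_mem_erase hw (hgi _ hvH w (mem_of_mem_erase hw) hvr hwr h).symm
          · simp only [Function.update_of_ne hji] at h
            exact hfg j hj w (mem_of_mem_erase hw) hwr h)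
      convert h1 using 1
      rw [← add_sum_erase I (fun j => Pi.single (Function.update pos i (f i) j) 2) hi,
        Function.update_self, add_assoc]
      congr 2
      refine sum_congr rfl fun j hj => ?_
      rw [Function.update_of_ne (ne_of_mem_erase hj)]

/-! ### Connectivity -/

theorem isAtLeastKConnected_vertexConnectivity {V : Type*} [Fintype V] [Nonempty V]
    (G : SimpleGraph V) : IsAtLeastKConnected G (vertexConnectivity G) :=
  Nat.sSup_mem (s := {k | IsAtLeastKConnected G k})
    ⟨0, Fintype.card_pos, fun _ h => absurd h (Nat.not_lt_zero _)⟩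
    ⟨Fintype.card V, fun _ h => h.1.le⟩

theorem not_isAtLeastKConnected_of_vertexConnectivity_lt {V : Type*} [Fintype V]
    {G : SimpleGraph V} {k : ℕ} (h : vertexConnectivity G < k) : ¬ IsAtLeastKConnected G k :=
  fun hk => absurd (le_csSup (s := {k | IsAtLeastKConnected G k})
    ⟨Fintype.card V, fun _ h => h.1.le⟩ hk) (not_le.2 h)

/-- In a `k`-connected graph, a nonempty vertex set that does not dominate some vertex outside of
it has at least `k` outer neighbours. -/
theorem IsAtLeastKConnected.le_card_boundary {V : Type*} [Fintype V] [DecidableEq V]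
    {G : SimpleGraph V} {k : ℕ} (h : IsAtLeastKConnected G k) {Z D : Finset V} {r z : V}
    (hz : z ∈ Z) (hr : r ∉ Z) (hrD : r ∉ D) (hzD : ∀ z ∈ Z, z ∉ D)
    (hD : ∀ z ∈ Z, ∀ v, G.Adj z v → v ∈ Z ∨ v ∈ D) : k ≤ #D := by
  by_contra! hlt
  have hconn := h.2 D hlt
  have hreach := hconn.preconnected ⟨z, hzD z hz⟩ ⟨r, hrD⟩
  rw [SimpleGraph.reachable_iff_reflTransGen] at hreach
  have : ∀ y : {v | v ∉ D}, ReflTransGen (G.induce {v | v ∉ D}).Adj ⟨z, hzD z hz⟩ y →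
      (y : V) ∈ Z := by
    intro y hy
    induction hy with
    | refl => exact hz
    | @tail b c _ hbc ih =>
      exact (hD _ ih _ (by simpa using hbc)).resolve_right c.2
  exact hr (this _ hreach)

/-- Serves both to select some of the far pairs and to shrink an unsolvable configuration to a
prescribed smaller size. -/
theorem exists_le_sum_eq {V : Type*} [DecidableEq V] (C : V → ℕ) (s : Finset V) :
    ∀ m ≤ ∑ v ∈ s, C v, ∃ D : V → ℕ, D ≤ C ∧ ∑ v ∈ s, D v = m := by
  induction s using Finset.induction_on with
  | empty => exact fun m hm => ⟨C, le_rfl, by simp at hm ⊢; exact hm.symm⟩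
  | insert a s ha ih =>
    intro m hm
    rw [sum_insert ha] at hm
    obtain ⟨D, hD, hs⟩ := ih (m - C a) (by omega)
    refine ⟨Function.update D a (min m (C a)), fun v => ?_, ?_⟩
    · rcases eq_or_ne v a with rfl | h
      · simp
      · simpa [h] using hD v
    · rw [sum_insert ha, Function.update_self, sum_update_of_notMem ha, hs]
      omega

/-! ### Upper bound -/

/-- In a `k`-connected graph, up to `k - d` pairs of pebbles on vertices far from `r` can all be
routed to `r` when all but `d` of the vertices other than `r` carry an additional pebble. -/
theorem IsAtLeastKConnected.isFoldSolvable {V : Type*} [Fintype V] [DecidableEq V]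
    {G : SimpleGraph V} {k : ℕ} (hconn : IsAtLeastKConnected G k) {r : V} {H : Finset V}
    (hrH : r ∉ H) (b : V → ℕ) (hb : ∀ v, b v ≠ 0 → v ≠ r ∧ ¬ G.Adj v r)
    (hbk : ∑ v, b v ≤ k - #(univ.erase r \ H)) :
    IsFoldSolvable G (∑ v, b v) r ((fun v => 2 * b v) + ∑ v ∈ H, Pi.single v 1) := by
  classical
  let O : Finset V := {v ∈ H | ¬ G.Adj v r}
  -- Each pair must choose a first vertex of `H`. Each vertex of `H` far from `r` must choose a
  -- successor in `H`, where choosing itself means that no route uses it. A system of distinct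
  -- representatives is a family of disjoint routes.
  let T : (Σ v, Fin (b v)) ⊕ {v // v ∈ O} → Finset V :=
    Sum.elim (fun i => {w ∈ H | G.Adj i.1 w}) (fun v => {w ∈ H | w = v ∨ G.Adj v w})
  have hall : ∀ s, #s ≤ #(s.biUnion T) := by
    intro s
    set Z := s.toRight.map (Function.Embedding.subtype _) with hZ
    have hmemZ : ∀ v ∈ Z, ∃ h : v ∈ O, Sum.inr ⟨v, h⟩ ∈ s := by
      intro v hv
      simpa [hZ] using hv
    have hcard : #s = #s.toLeft + #Z := by
      rw [hZ, card_map, card_toLeft_add_card_toRight]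
    have hZU : Z ⊆ s.biUnion T := by
      intro v hv
      obtain ⟨hO, hs⟩ := hmemZ v hv
      exact mem_biUnion.2 ⟨_, hs, by simp [T, (mem_filter.1 hO).1]⟩
    rcases s.toLeft.eq_empty_or_nonempty with hY | ⟨i, hi⟩
    · rw [hcard, hY, card_empty, zero_add]
      exact card_le_card hZU
    have hfst : ∀ i : Σ v, Fin (b v), i.1 ≠ r ∧ ¬ G.Adj i.1 r := fun i =>
      hb _ fun h => by have := i.2.2; omega
    -- `Z'` avoids the closed neighbourhood of `r`, so it has at least `k` outer neighbours, of
    -- which at most `d` miss `H`. The others are available choices outside `Z`, enough for all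
    -- pairs, while `Z` itself accounts for the vertices in `s`.
    set Z' := Z ∪ s.toLeft.image Sigma.fst with hZ'
    have hZ'r : ∀ z ∈ Z', z ≠ r ∧ ¬ G.Adj z r := by
      intro z hz
      rcases mem_union.1 hz with hz | hz
      · obtain ⟨hO, -⟩ := hmemZ z hz
        obtain ⟨hH, hadj⟩ := mem_filter.1 hO
        exact ⟨fun h => hrH (h ▸ hH), hadj⟩
      · obtain ⟨i, -, rfl⟩ := mem_image.1 hz
        exact hfst i
    set B : Finset V := {v | v ∉ Z' ∧ ∃ z ∈ Z', G.Adj z v} with hB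
    have hkB : k ≤ #B := by
      refine hconn.le_card_boundary (Z := Z') (r := r) (z := i.1)
        (mem_union_right _ (mem_image_of_mem _ hi)) (fun h => (hZ'r r h).1 rfl) ?_ ?_ ?_
      · intro h
        obtain ⟨-, z, hz, hzr⟩ := (mem_filter.1 h).2
        exact (hZ'r z hz).2 hzr
      · intro z hz h
        exact (mem_filter.1 h).2.1 hz
      · intro z hz v hzv
        by_cases hv : v ∈ Z'
        · exact .inl hv
        · exact .inr (by simpa [hB] using ⟨hv, z, hz, hzv⟩)
    have h1 : B ∩ H ⊆ s.biUnion T \ Z := by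
      intro v hv
      obtain ⟨hvB, hvH⟩ := mem_inter.1 hv
      obtain ⟨hvZ, z, hz, hzv⟩ := (mem_filter.1 hvB).2
      refine mem_sdiff.2 ⟨?_, fun h => hvZ (mem_union_left _ h)⟩
      rcases mem_union.1 hz with hz | hz
      · obtain ⟨hO, hs⟩ := hmemZ z hz
        exact mem_biUnion.2 ⟨_, hs, by simp [T, hvH, hzv]⟩
      · obtain ⟨i, his, rfl⟩ := mem_image.1 hz
        exact mem_biUnion.2 ⟨_, mem_toLeft.1 his, by simp [T, hvH, hzv]⟩
    have h2 : B \ H ⊆ univ.erase r \ H := by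
      intro v hv
      obtain ⟨hvB, hvH⟩ := mem_sdiff.1 hv
      obtain ⟨-, z, hz, hzv⟩ := (mem_filter.1 hvB).2
      refine mem_sdiff.2 ⟨mem_erase.2 ⟨?_, mem_univ _⟩, hvH⟩
      rintro rfl
      exact (hZ'r z hz).2 hzv
    have h3 := card_le_card h1
    have h4 := card_le_card h2
    have h5 := card_inter_add_card_sdiff B H
    have h6 := card_sdiff_add_card_eq_card hZU
    have h7 : #s.toLeft ≤ ∑ v, b v := by
      simpa using card_le_univ s.toLeft
    omega
  obtain ⟨F, hF, hFT⟩ := (all_card_le_biUnion_card_iff_exists_injective T).1 hall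
  have hO : ∀ v ∈ H, ¬ G.Adj v r → v ∈ O := fun v hv h => mem_filter.2 ⟨hv, h⟩
  let g : V → V := fun v => if h : v ∈ O then F (.inr ⟨v, h⟩) else v
  have key := isFoldSolvable_of_matching (G := G) (r := r) g #H univ Sigma.fst
    (fun i => F (.inl i)) H rfl
    (fun i _ => by simpa [T] using hFT (.inl i))
    (fun v hv hvr => by simpa [T, g, hO v hv hvr] using hFT (.inr ⟨v, hO v hv hvr⟩))
    (fun i _ j _ h => by simpa using hF h)
    (fun v hv w hw hvr hwr h => by
      simp only [g, hO v hv hvr, hO w hw hwr, dif_pos] at h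
      simpa using hF h)
    (fun i _ v hv hvr h => by
      simp only [g, hO v hv hvr, dif_pos] at h
      simpa using hF h)
  convert key using 1
  · simp
  · congr 1
    rw [Fintype.sum_sigma]
    ext v
    simp [Finset.sum_apply, Pi.single_apply, mul_comm]

/-- Pairs of pebbles outside the closed neighbourhood of `r` meet at the universal vertex. -/
theorem isFoldSolvable_of_isUniversal {V : Type*} [Fintype V] [DecidableEq V]
    {G : SimpleGraph V} {u r : V} (hu : G.IsUniversal u) (b : V → ℕ)
    (hb : ∀ v, b v ≠ 0 → v ≠ r ∧ ¬ G.Adj v r) :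
    IsFoldSolvable G ((∑ v, b v) / 2) r (fun v => 2 * b v) := by
  rcases eq_or_ne u r with rfl | hur
  · have h0 : ∀ v, b v = 0 := fun v => by
      by_contra h
      exact (hb v h).2 (hu (hb v h).1.symm).symm
    simpa [h0] using IsFoldSolvable.of_zero G u _
  · have hadj := hu hur
    refine .of_reach (pebblingReach_neighbor (x := u) b fun v hv => (hu ?_).symm) ?_
    · rintro rfl
      exact (hb _ hv).2 hadj
    · refine (IsFoldSolvable.of_reach (pebblingReach_single hadj _)
        (isFoldSolvable_single G r ((∑ v, b v) / 2))).mono_config ?_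
      exact Pi.single_mono _ (Nat.mul_div_le _ _)

theorem isFoldSolvable_of_le_size {V : Type*} [Fintype V] {G : SimpleGraph V} {k t : ℕ}
    (hconn : IsAtLeastKConnected G k) {u : V} (hu : G.IsUniversal u) (r : V)
    (C : PebblingConfig V) (h1 : Fintype.card V + 4 * t ≤ C.size + k + 2)
    (h2 : Fintype.card V + 2 * t ≤ C.size + 2) : IsFoldSolvable G t r C := by
  classical
  let H : Finset V := {v | v ≠ r ∧ C v % 2 = 1}
  let qN : V → ℕ := fun v => if G.Adj v r then C v / 2 else 0
  let qB : V → ℕ := fun v => if v ≠ r ∧ ¬ G.Adj v r then C v / 2 else 0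
  have hrH : r ∉ H := by simp [H]
  have hqB : ∀ v, qB v ≠ 0 → v ≠ r ∧ ¬ G.Adj v r := fun v hv => by
    by_contra h
    exact hv (if_neg h)
  have hqN : ∀ v, qN v ≠ 0 → G.Adj v r := fun v hv => by
    by_contra h
    exact hv (if_neg h)
  have hC : C = Pi.single r (C r) + (fun v => 2 * qN v) + ((fun v => 2 * qB v) +
      ∑ v ∈ H, Pi.single v 1) := by
    funext v
    simp only [Pi.add_apply, Finset.sum_apply, Pi.single_apply, sum_ite_eq, H, qN, qB]
    rcases eq_or_ne v r with rfl | hvr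
    · simp
    · by_cases ha : G.Adj v r <;> simp [hvr, ha] <;> split_ifs <;> omega
  have hsize : C.size = C r + 2 * ∑ v, qN v + (2 * ∑ v, qB v + #H) := by
    conv_lhs => rw [hC]
    simp [PebblingConfig.size, sum_add_distrib, mul_sum, Finset.sum_apply]
  have hH : #(univ.erase r \ H) + #H + 1 = Fintype.card V := by
    rw [card_sdiff_add_card_eq_card fun v hv => mem_erase.2
      ⟨ne_of_mem_of_not_mem hv hrH, mem_univ v⟩, card_erase_add_one (mem_univ r), card_univ]
  -- Route individually as many far pairs as the connectivity allows, but no more than are still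
  -- needed. Hypothesis `h2` ensures, after rounding for parity, that enough far pairs exist.
  obtain ⟨b, hbq, hbs⟩ := exists_le_sum_eq qB univ
    (min (t - C r - ∑ v, qN v) (k - #(univ.erase r \ H))) (by omega)
  have hb : ∀ v, b v ≠ 0 → v ≠ r ∧ ¬ G.Adj v r := fun v hv =>
    hqB v fun h => hv (Nat.le_zero.1 (h ▸ hbq v))
  have hc : ∀ v, (qB - b) v ≠ 0 → v ≠ r ∧ ¬ G.Adj v r := fun v hv =>
    hqB v fun h => hv (by simp [h])
  have hsum : ∑ v, (qB - b) v + ∑ v, b v = ∑ v, qB v := by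
    rw [← sum_add_distrib]
    exact sum_congr rfl fun v _ => Nat.sub_add_cancel (hbq v)
  have s1 := isFoldSolvable_single G r (C r)
  have s2 := IsFoldSolvable.of_reach (pebblingReach_neighbor qN hqN)
    (isFoldSolvable_single G r (∑ v, qN v))
  have s3 := hconn.isFoldSolvable hrH b hb (by omega)
  have s4 := isFoldSolvable_of_isUniversal hu (qB - b) hc
  have s5 := (s1.add s2).add (s4.add s3)
  have hsplit : (fun v => 2 * qB v) = (fun v => 2 * (qB - b) v) + fun v => 2 * b v := by
    funext v
    have : b v ≤ qB v := hbq v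
    simp only [Pi.add_apply, Pi.sub_apply]
    omega
  rw [← add_assoc (fun v => 2 * (qB - b) v), ← hsplit, ← hC] at s5
  -- If the first term of the minimum is attained, the routed pairs complete the demand. Otherwise
  -- `h1` makes the unrouted far pairs, at half a pebble each, sufficient.
  exact s5.anti (by omega)

/-! ### Lower bound -/

/-- Only the two ends of the step change, so a local inequality along edges suffices. The weights `φ
v` need not be linear, which allows floors that ignore single pebbles. -/
theorem PebblingStep.sum_le {V : Type*} [Fintype V] {G : SimpleGraph V} {φ : V → ℕ → ℕ}
    (hφ : ∀ u v a b, G.Adj u v → φ u a + φ v (b + 1) ≤ φ u (a + 2) + φ v b)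
    {C C' : PebblingConfig V} (h : PebblingStep G C C') :
    ∑ v, φ v (C' v) ≤ ∑ v, φ v (C v) := by
  classical
  obtain ⟨u, v, ha, hu, hv, hw⟩ := h
  have hvu : v ∈ univ.erase u := mem_erase.2 ⟨ha.ne', mem_univ v⟩
  rw [← add_sum_erase univ (fun v => φ v (C' v)) (mem_univ u),
    ← add_sum_erase univ (fun v => φ v (C v)) (mem_univ u),
    ← add_sum_erase _ (fun v => φ v (C' v)) hvu, ← add_sum_erase _ (fun v => φ v (C v)) hvu,
    sum_congr rfl fun w hw' => by
      rw [hw w (ne_of_mem_erase (mem_of_mem_erase hw')) (ne_of_mem_erase hw')]]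
  have := hφ u v (C' u) (C v) ha
  rw [hu, hv]
  omega

theorem PebblingReach.sum_le {V : Type*} [Fintype V] {G : SimpleGraph V} {φ : V → ℕ → ℕ}
    (hφ : ∀ u v a b, G.Adj u v → φ u a + φ v (b + 1) ≤ φ u (a + 2) + φ v b)
    {C C' : PebblingConfig V} (h : PebblingReach G C C') :
    ∑ v, φ v (C' v) ≤ ∑ v, φ v (C v) := by
  induction h with
  | refl => exact le_rfl
  | tail _ h ih => exact (h.sum_le hφ).trans ih

/-- All vertices but `s` carry at most one pebble, and the set `S` is empty and separates `R` from the remaining vertices. -/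
theorem not_isFoldSolvable_of_separated {V : Type*} [Fintype V] [DecidableEq V]
    {G : SimpleGraph V} {r s : V} {R S : Finset V} (hr : r ∈ R)
    (hsep : ∀ v ∈ R, ∀ w, G.Adj v w → w ∈ R ∨ w ∈ S) {t : ℕ} {C : PebblingConfig V}
    (hCr : C r = 0) (hCS : ∀ v ∈ S, C v = 0) (hC : ∀ v, v ≠ s → C v ≤ 1)
    (hs : (if s ∈ R then 2 * (C s / 2) else C s / 2) < 2 * t) :
    ¬ IsFoldSolvable G t r C := by
  rintro ⟨C', hreach, ht⟩
  -- A pebble on `r` is worth 2, a pair elsewhere in `R` is worth 2, a pebble on the cut is worth 1,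
  -- and a pair beyond the cut is worth 1. No edge joins `R` to the far side, so no step gains.
  -- Initially only `s` can have positive weight, since single pebbles off the cut round down to 0.
  let φ : V → ℕ → ℕ := fun v c =>
    if v = r then 2 * c else if v ∈ R then 2 * (c / 2) else if v ∈ S then c else c / 2
  have hφ : ∀ u v a b, G.Adj u v → φ u a + φ v (b + 1) ≤ φ u (a + 2) + φ v b := by
    intro u v a b huv
    have h1 := hsep u
    have h2 := hsep v
    by_cases huR : u ∈ R
    · have h3 := h1 huR v huv
      simp only [φ, huR]
      split_ifs <;> omega
    · have hur : u ≠ r := fun h => huR (h ▸ hr)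
      by_cases hvR : v ∈ R
      · have h3 := (h2 hvR u huv.symm).resolve_left huR
        simp only [φ, huR, hur, h3]
        split_ifs <;> omega
      · have hvr : v ≠ r := fun h => hvR (h ▸ hr)
        simp only [φ, huR, hur, hvR, hvr]
        split_ifs <;> omega
  have h := PebblingReach.sum_le hφ hreach
  have h1 : φ r (C' r) ≤ ∑ v, φ v (C' v) :=
    single_le_sum (f := fun v => φ v (C' v)) (fun _ _ => Nat.zero_le _) (mem_univ r)
  have h2 : ∑ v, φ v (C v) = φ s (C s) := by
    refine sum_eq_single s (fun v _ hv => ?_) (by simp)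
    have := hC v hv
    rcases eq_or_ne v r with rfl | hvr
    · simp [φ, hCr]
    · by_cases hvS : v ∈ S
      · simp [φ, hvr, hCS v hvS]
      · simp only [φ, hvr, hvS, if_false]
        split_ifs <;> omega
  have h3 : φ s (C s) < 2 * t := by
    rcases eq_or_ne s r with rfl | hsr
    · simp only [φ, if_true, hCr] at hs ⊢
      simp at hs
      omega
    · by_cases hsS : s ∈ S
      · rw [hCS s hsS] at hs ⊢
        simp [φ] at hs ⊢
        omega
      · simpa [φ, hsr, hsS] using hs
  have h4 : φ r (C' r) = 2 * C' r := if_pos rfl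
  omega

/-- The configuration with `a` pebbles on `s`, none on `r` and `S`, and one on all other
vertices. -/
theorem exists_not_isFoldSolvable {V : Type*} [Fintype V] [DecidableEq V]
    {G : SimpleGraph V} {r s : V} {R S : Finset V} (hr : r ∈ R) (hRS : Disjoint R S)
    (hsep : ∀ v ∈ R, ∀ w, G.Adj v w → w ∈ R ∨ w ∈ S) (hsr : s ≠ r) (hsS : s ∉ S) {t a : ℕ}
    (hs : (if s ∈ R then 2 * (a / 2) else a / 2) < 2 * t) :
    ∃ C : PebblingConfig V, C.size + #S + 2 = Fintype.card V + a ∧ ¬ IsFoldSolvable G t r C := by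
  have hrS : r ∉ S := disjoint_left.1 hRS hr
  refine ⟨fun v => if v = s then a else if v = r ∨ v ∈ S then 0 else 1, ?_,
    not_isFoldSolvable_of_separated hr hsep (s := s) (by simp [hsr.symm])
      (fun v hv => ?_) (fun v hv => ?_) (by simpa using hs)⟩
  · have h1 : PebblingConfig.size (fun v => if v = s then a else if v = r ∨ v ∈ S then 0 else 1) =
        a + #(univ \ insert s (insert r S)) := by
      rw [PebblingConfig.size, ← add_sum_erase univ _ (mem_univ s), if_pos rfl, card_eq_sum_ones,
        ← sum_filter_add_sum_filter_not (univ.erase s) (fun v => v = r ∨ v ∈ S)]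
      congr 1
      rw [sum_eq_zero, zero_add]
      · refine sum_congr ?_ fun v hv => ?_
        · ext v; simp
        · simp at hv
          simp [hv]
      · intro v hv
        simp at hv
        simp [hv]
    have h2 := card_sdiff_add_card_eq_card (subset_univ (insert s (insert r S)))
    rw [card_insert_of_notMem (by simp [hsr, hsS]), card_insert_of_notMem hrS, card_univ] at h2
    omega
  · have : v ≠ s := fun h => hsS (h ▸ hv)
    simp [this, hv]
  · simp only [hv, if_false]
    split_ifs <;> simp

/-- A graph that is not complete has a vertex cut of at most `vertexConnectivity G` vertices. -/
theorem exists_separation {V : Type*} [Fintype V] [DecidableEq V] {G : SimpleGraph V}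
    (hG : G ≠ ⊤) : vertexConnectivity G + 2 ≤ Fintype.card V ∧
    ∃ (R S : Finset V) (r s : V), r ∈ R ∧ Disjoint R S ∧ s ∉ R ∧ s ∉ S ∧
      #S ≤ vertexConnectivity G ∧ ∀ v ∈ R, ∀ w, G.Adj v w → w ∈ R ∨ w ∈ S := by
  classical
  obtain ⟨a, b, hab, hnadj⟩ := SimpleGraph.ne_top_iff_exists_not_adj.1 hG
  have : Nonempty V := ⟨a⟩
  have hcard2 : 2 ≤ Fintype.card V := Fintype.one_lt_card_iff.2 ⟨a, b, hab⟩
  have hle : vertexConnectivity G + 2 ≤ Fintype.card V := by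
    have h := isAtLeastKConnected_vertexConnectivity G
    -- Deleting everything except the non-adjacent `a` and `b` disconnects the graph, so the
    -- connectivity is at most `n - 2`. Hence, below, failure of `(k + 1)`-connectivity must come
    -- from a cut and not from too few vertices.
    have h1 := h.le_card_boundary (Z := {a}) (D := univ \ {a, b}) (r := b) (z := a) (by simp)
      (by simpa using hab.symm) (by simp) (by simp) (by
        intro z hz v hzv
        rw [mem_singleton.1 hz] at hzv
        refine .inr ?_
        simpa using ⟨hzv.ne', fun h => hnadj (h ▸ hzv)⟩)
    have h2 := card_sdiff_add_card_eq_card (subset_univ ({a, b} : Finset V))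
    rw [card_pair hab, card_univ] at h2
    omega
  refine ⟨hle, ?_⟩
  have hnot := not_isAtLeastKConnected_of_vertexConnectivity_lt
    (Nat.lt_succ_self (vertexConnectivity G))
  simp only [IsAtLeastKConnected, not_and, not_forall] at hnot
  obtain ⟨S, hS, hSconn⟩ := hnot (by omega)
  have hne : ∃ v, v ∉ S := by
    by_contra! h
    rw [eq_univ_of_forall h, card_univ] at hS
    omega
  have hpre : ¬ (G.induce {v | v ∉ S}).Preconnected := fun h =>
    hSconn ((SimpleGraph.connected_iff _).2 ⟨h, ⟨⟨hne.choose, hne.choose_spec⟩⟩⟩)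
  simp only [SimpleGraph.Preconnected, not_forall] at hpre
  obtain ⟨r, s, hrs⟩ := hpre
  -- `R` is the component of `r` after deletion of `S`.
  refine ⟨({v | ∃ h : v ∉ S, (G.induce {v | v ∉ S}).Reachable r ⟨v, h⟩} : Finset V), S, r, s, ?_, ?_, ?_,
    s.2, by omega, ?_⟩
  · exact mem_filter.2 ⟨mem_univ _, r.2, SimpleGraph.Reachable.refl _⟩
  · rw [disjoint_left]
    intro v hv
    exact (mem_filter.1 hv).2.1
  · simpa using fun _ => hrs
  · intro v hv w hvw
    obtain ⟨hvS, hv⟩ := (mem_filter.1 hv).2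
    by_cases hw : w ∈ S
    · exact .inr hw
    · refine .inl (mem_filter.2 ⟨mem_univ _, hw, hv.trans (SimpleGraph.Adj.reachable ?_)⟩)
      simpa using hvw

/-- Solvability is monotone in the configuration, so an unsolvable one contains unsolvable ones of
every smaller size, and no smaller `m` can qualify in the infimum. -/
theorem le_rootedPebblingNumber_of_not_isFoldSolvable {V : Type*} [Fintype V] {G : SimpleGraph V} {t : ℕ} {r : V}
    {m : ℕ} {C : PebblingConfig V} (hm : m ≤ C.size + 1) (hC : ¬ IsFoldSolvable G t r C) :
    m ≤ rootedPebblingNumber G t r := by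
  classical
  refine le_sInf ?_
  rintro _ ⟨l, rfl, -, hl⟩
  rw [Nat.cast_le]
  by_contra! h
  obtain ⟨D, hD, hs⟩ := exists_le_sum_eq C univ l (Nat.le_of_lt_succ (h.trans_le hm))
  exact hC ((hl D hs).mono_config hD)

theorem theorem3 {V : Type*} [Fintype V] (G : SimpleGraph V) (n k t : ℕ) (ht : 1 ≤ t)
    (hn : Fintype.card V = n) (hk : vertexConnectivity G = k)
    (hu : ∃ u : V, G.IsUniversal u) (hG : G ≠ ⊤) :
    (∃ m : ℕ, pebblingNumber G t = (m : ℕ∞) ∧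
      (m : ℤ) = max ((n : ℤ) + 4 * t - k - 2) ((n : ℤ) + 2 * t - 2)) ∧
    ((n : ℤ) + 4 * t - k - 2 ≤ (n : ℤ) + 2 * t - 2 ↔ 2 * t ≤ k) := by
  classical
  refine ⟨?_, by omega⟩
  obtain ⟨u, hu⟩ := hu
  have : Nonempty V := ⟨u⟩
  have hconn := isAtLeastKConnected_vertexConnectivity G
  obtain ⟨hkn, R, S, r, s, hr, hRS, hsR, hsS, hS, hsep⟩ := exists_separation hG
  rw [hk] at hconn hkn hS
  rw [hn] at hkn
  have hsr : s ≠ r := fun h => hsR (h ▸ hr)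
  refine ⟨max (n + 4 * t - k - 2) (n + 2 * t - 2), le_antisymm ?_ ?_, by omega⟩
  · refine iSup_le fun r => sInf_le ⟨_, rfl, by omega, fun C hC => ?_⟩
    exact isFoldSolvable_of_le_size hconn hu r C (by omega) (by omega)
  -- `4 * t - 1` is the largest `a` with `a / 2 < 2 * t`, the potential bound for `s` beyond the
  -- cut.
  · obtain ⟨C, hC, hCs⟩ := exists_not_isFoldSolvable (t := t) (a := 4 * t - 1) hr hRS hsep hsr hsS
      (by rw [if_neg hsR]; omega)
    -- With no cut `s` lies in `R`, and `2 * t - 1` is the largest `a` with `2 * (a / 2) < 2 * t`.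
    obtain ⟨D, hD, hDs⟩ := exists_not_isFoldSolvable (G := G) (R := univ) (S := ∅) (t := t)
      (a := 2 * t - 1) (mem_univ r) (by simp) (by simp) hsr (by simp) (by simp; omega)
    rw [card_empty] at hD
    refine le_trans ?_ (le_iSup (rootedPebblingNumber G t) r)
    rcases le_total (n + 4 * t - k - 2) (n + 2 * t - 2) with h | h
    · rw [max_eq_right h]
      exact le_rootedPebblingNumber_of_not_isFoldSolvable (by omega) hDs
    · rw [max_eq_left h]
      exact le_rootedPebblingNumber_of_not_isFoldSolvable (by omega) hCs
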